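/- Let $(X_i)_{i=-\infty}^{\infty}$ be a stationary process on a probability space with values in a finite alphabet $\mathbb{X}$, and write $X_1^n=(X_1,\dots,X_n)$. Let $\log$ be the logarithm to a fixed base $b\ge 2$ (for example $b=2$ or $b=e$), let $\exp(y)=b^y$ be its inverse, and let $\sigma(y)=\min(\exp(y),1)$. Let $\mathcal{I}$ be the shift-invariant $\sigma$-algebra of the process, that is, the $\sigma$-algebra of the events $\{(X_i)_{i\in\mathbb{Z}}\in B\}$ with $B$ a shift-invariant measurable set of two-sided sequences over $\mathbb{X}$. Put $H(X_1^n)=-\sum_{w\in\mathbb{X}^n}P(X_1^n=w)\log P(X_1^n=w)$ and $H(X_1^k|\mathcal{I})=\mathbf{E}\left[-\sum_{w\in\mathbb{X}^k}P(X_1^k=w|\mathcal{I})\log P(X_1^k=w|\mathcal{I})\right]$, with $0\log 0=0$. Then for all natural numbers $p,k\ge 1$, $n=pk$, and every real number $m\ge 1$, $$\frac{H(X_1^{n})}{n}-\frac{H(X_1^k|\mathcal{I})}{k}\le\frac{2}{k}+\frac{2}{n}\log k+3\log|\mathbb{X}|\left(\frac{1}{m}+\left(1-\frac{1}{m}\right)\sigma\left(m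 H(X_1^k|\mathcal{I})-\log\frac{n}{k}\right)+\frac{k}{n}\right).$$ -/

import Mathlib

open MeasureTheory ProbabilityTheory

namespace BlockEntropy

noncomputable section

variable {Ω A S : Type*}

/-- The left shift on two-sided sequences: `(shift x) i = x (i + 1)`. -/
def shift (x : ℤ → A) : ℤ → A := fun i => x (i + 1)

/-- The trajectory `ω ↦ (X i ω)` (over all integers `i`) of a process. -/
def path (X : ℤ → Ω → A) (ω : Ω) : ℤ → A := fun i => X i ω

/-- The process `X` is stationary under `μ`: its law on two-sided sequences (with the product
σ-algebra) is invariant under the shift. -/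
def IsStationary [MeasurableSpace Ω] [MeasurableSpace A] (X : ℤ → Ω → A) (μ : Measure Ω) : Prop :=
  MeasurePreserving shift (μ.map (path X)) (μ.map (path X))

/-- The shift-invariant σ-algebra of the process `X`: the events `{path X ∈ B}`, where `B` is a
measurable set of two-sided sequences with `shift ⁻¹' B = B`. -/
@[reducible]
def invariantAlgebra [MeasurableSpace A] (X : ℤ → Ω → A) : MeasurableSpace Ω :=
  (MeasurableSpace.invariants (shift : (ℤ → A) → (ℤ → A))).comap (path X)

/-- The block `(X 1, …, X n)`. -/
def block (X : ℤ → Ω → A) (n : ℕ) (ω : Ω) : Fin n → A := fun i => X ((i : ℤ) + 1) ω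

/-- Entropy, with logarithms to base `b`, of the distribution of a random variable with finitely
many values: `-∑ P(Y = w) log P(Y = w)`, where a term with `P(Y = w) = 0` contributes `0`. -/
def entropy [MeasurableSpace Ω] [Fintype S] (b : ℝ) (μ : Measure Ω) (Y : Ω → S) : ℝ :=
  -∑ w : S, μ.real (Y ⁻¹' {w}) * Real.logb b (μ.real (Y ⁻¹' {w}))

/-- Conditional entropy, with logarithms to base `b`, of a random variable with finitely many
values given a σ-algebra `m`: the expectation of the entropy `-∑ P(Y = w | m) log P(Y = w | m)` of
the conditional distribution. -/
def condEntropy [MeasurableSpace Ω] [Fintype S] (b : ℝ) (μ : Measure Ω) (Y : Ω → S)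
    (m : MeasurableSpace Ω) : ℝ :=
  ∫ ω, -∑ w : S, (μ⟦Y ⁻¹' {w} | m⟧) ω * Real.logb b ((μ⟦Y ⁻¹' {w} | m⟧) ω) ∂μ

/-- `σ(y) = min(exp y, 1)`, where `exp y = b ^ y` is the inverse of the logarithm to base `b`. -/
def cutExp (b y : ℝ) : ℝ := min (b ^ y) 1

/-- The shift-invariant σ-algebra of a process of measurable variables consists of events. -/
theorem invariantAlgebra_le [mΩ : MeasurableSpace Ω] [MeasurableSpace A] (X : ℤ → Ω → A)
    (hX : ∀ i, Measurable (X i)) : invariantAlgebra X ≤ mΩ := by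
  rintro _ ⟨B, hB, rfl⟩
  exact (measurable_pi_lambda (path X) hX) (MeasurableSpace.invariants_le shift _ hB)

end

end BlockEntropy

namespace BlockEntropy

/-! Cut the word of length `n = p * k` into `p` blocks and view it as a word of `p` letters over the
alphabet of `k`-blocks. By Gibbs' inequality its entropy is at most its expected code length under
any subprobability. `codeWeight` is chosen so that this length is `p` times the entropy of the
empirical block distribution, plus three times the log of the number of possible blocks for each
distinct block that occurs, plus `p * log 4`.

Stationarity gives all blocks the same conditional distribution given the invariant σ-algebra, so
the conditional mean of the empirical distribution is that common distribution `r`. The empirical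
entropy and the number of distinct blocks, which is `∑ w, min (p * empirical y w) 1`, are both sums
of concave functions of empirical frequencies. Conditional Jensen (`integral_concave_empirical_le`)
therefore bounds their means by the same expressions in `r`. The first becomes the conditional
entropy `h`; a Markov argument at threshold `t * h` on the self-information bounds the second
(`sum_integral_min_le`). Dividing by `n` concludes. -/

/-- Gibbs' inequality for a probability vector `P` and a subprobability vector `Q`. -/
theorem sum_negMulLog_le_sum_mul_neg_log {S : Type*} [Fintype S]
    {P Q : S → ℝ} (hP : ∀ y, 0 ≤ P y) (hP1 : ∑ y, P y = 1)
    (hQ : ∀ y, 0 < Q y) (hQ1 : ∑ y, Q y ≤ 1) :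
    ∑ y, Real.negMulLog (P y) ≤ ∑ y, P y * -Real.log (Q y) := by
  have h : ∀ y, Real.negMulLog (P y) - P y * -Real.log (Q y) ≤ Q y - P y := by
    intro y
    rcases (hP y).eq_or_lt with h0 | h0
    · simp [← h0, (hQ y).le]
    · have := Real.log_le_sub_one_of_pos (div_pos (hQ y) h0)
      rw [Real.log_div (hQ y).ne' h0.ne'] at this
      have h2 := mul_le_mul_of_nonneg_left this h0.le
      rw [mul_sub (P y) (Q y / P y), mul_div_cancel₀ _ h0.ne'] at h2
      rw [Real.negMulLog]
      linarith
  have := Finset.sum_le_sum fun y (_ : y ∈ Finset.univ) => h y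
  rw [Finset.sum_sub_distrib, Finset.sum_sub_distrib] at this
  linarith

/-! ### A universal code for words, and its Kraft inequality -/

section Code

variable {S : Type*} [DecidableEq S] {p : ℕ}

/-- The number of occurrences of `w` in the word `y`. -/
def letterCount (y : Fin p → S) (w : S) : ℕ := (Finset.univ.filter fun j => y j = w).card

/-- The empirical distribution of the letters of the word `y`. -/
noncomputable def empirical (y : Fin p → S) (w : S) : ℝ := letterCount y w / p

/-- The number of distinct letters of the word `y`. -/
def vocabularySize (y : Fin p → S) : ℕ := (Finset.univ.image y).card

theorem letterCount_le (y : Fin p → S) (w : S) : letterCount y w ≤ p :=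
  (Finset.card_filter_le _ _).trans (by simp)

theorem sum_letterCount [Fintype S] (y : Fin p → S) : ∑ w, letterCount y w = p := by
  have h := Finset.card_eq_sum_card_fiberwise (s := (Finset.univ : Finset (Fin p))) (f := y)
    (t := Finset.univ) (fun _ _ => Finset.mem_coe.2 (Finset.mem_univ _))
  simpa [letterCount] using h.symm

theorem letterCount_pos (y : Fin p → S) (j : Fin p) : 0 < letterCount y (y j) :=
  Finset.card_pos.2 ⟨j, by simp⟩

theorem letterCount_eq_zero_iff (y : Fin p → S) (w : S) :
    letterCount y w = 0 ↔ w ∉ Finset.univ.image y := by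
  simp [letterCount, Finset.filter_eq_empty_iff]

theorem empirical_apply_pos (y : Fin p → S) (j : Fin p) : 0 < empirical y (y j) := by
  have := letterCount_pos y j
  have := j.pos
  unfold empirical
  positivity

variable [Fintype S]

theorem pow_vocabularySize (t : ℝ) (y : Fin p → S) :
    t ^ vocabularySize y = ∏ w, if letterCount y w = 0 then 1 else t := by
  simp only [letterCount_eq_zero_iff, ite_not]
  rw [Finset.prod_ite_mem, Finset.univ_inter, Finset.prod_const, vocabularySize]

/-- A count of zero contributes 1, and the positive counts share `t` times a geometric series of sum
below 1. -/
theorem sum_geometric_weight_le {t : ℝ} (ht : 0 ≤ t) (n : ℕ) :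
    ∑ c ∈ Finset.range (n + 1), (1 / 2 : ℝ) ^ c * (if c = 0 then 1 else t) ≤ 1 + t := by
  have h : ∀ n : ℕ, ∑ c ∈ Finset.range (n + 1), (1 / 2 : ℝ) ^ c * (if c = 0 then 1 else t)
      = 1 + t * (1 - (1 / 2) ^ n) := by
    intro n
    induction n with
    | zero => simp
    | succ n ih =>
      rw [Finset.sum_range_succ, ih, if_neg (Nat.succ_ne_zero n)]
      ring
  rw [h]
  have : (0 : ℝ) ≤ (1 / 2) ^ n := by positivity
  nlinarith

/-- The words with prescribed letter counts have total probability at most one under the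
memoryless distribution with the corresponding letter frequencies. -/
theorem sum_prod_empirical_le (hp : p ≠ 0) (c : S → ℕ) :
    ∑ y : Fin p → S with letterCount y = c, ∏ j, empirical y (y j) ≤ 1 := by
  by_cases hc : ∃ y : Fin p → S, letterCount y = c
  · obtain ⟨y₀, rfl⟩ := hc
    calc ∑ y : Fin p → S with letterCount y = letterCount y₀, ∏ j, empirical y (y j)
        = ∑ y : Fin p → S with letterCount y = letterCount y₀, ∏ j, empirical y₀ (y j) := by
          refine Finset.sum_congr rfl fun y hy => ?_
          simp only [empirical, (Finset.mem_filter.1 hy).2]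
      _ ≤ ∑ y : Fin p → S, ∏ j, empirical y₀ (y j) :=
          Finset.sum_le_sum_of_subset_of_nonneg (Finset.filter_subset _ _)
            fun y _ _ => Finset.prod_nonneg fun j _ => by unfold empirical; positivity
      _ = (∑ w, empirical y₀ w) ^ p := (Fintype.sum_pow _ _).symm
      _ = 1 := by
          have : (p : ℝ) ≠ 0 := by exact_mod_cast hp
          simp only [empirical]
          rw [← Finset.sum_div, ← Nat.cast_sum, sum_letterCount, div_self this, one_pow]
  · rw [Finset.filter_false_of_mem fun y _ h => hc ⟨y, h⟩]
    simp

/-- Group words by their letter counts `c`. Within a group the vocabulary factor is constant and the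
products sum to at most 1. The sum over `c` is enlarged to a full box, where it factorises over
letters. -/
theorem sum_pow_vocabularySize_mul_prod_empirical_le (hp : p ≠ 0) {t : ℝ} (ht : 0 ≤ t) :
    ∑ y : Fin p → S, t ^ vocabularySize y * ∏ j, empirical y (y j)
      ≤ 2 ^ p * (1 + t) ^ Fintype.card S := by
  classical
  set u : ℕ → ℝ := fun c => if c = 0 then 1 else t with hu
  have hu0 : ∀ c, 0 ≤ u c := fun c => by simp only [hu]; split_ifs <;> positivity
  calc ∑ y : Fin p → S, t ^ vocabularySize y * ∏ j, empirical y (y j)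
      = ∑ c ∈ Fintype.piFinset fun _ : S => Finset.range (p + 1),
          ∑ y : Fin p → S with letterCount y = c,
            t ^ vocabularySize y * ∏ j, empirical y (y j) :=
        (Finset.sum_fiberwise_of_maps_to (fun y _ => Fintype.mem_piFinset.2 fun w =>
          Finset.mem_range.2 (Nat.lt_succ_of_le (letterCount_le y w))) _).symm
    _ ≤ ∑ c ∈ Fintype.piFinset fun _ : S => Finset.range (p + 1),
          2 ^ p * ∏ w, ((1 / 2 : ℝ) ^ c w * u (c w)) := by
        refine Finset.sum_le_sum fun c _ => ?_
        by_cases hc : ∃ y : Fin p → S, letterCount y = c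
        · obtain ⟨y₀, rfl⟩ := hc
          -- Attainable counts sum to `p`, so the powers of 1/2 multiply to `2⁻ᵖ` and cancel `2 ^
          -- p`; they make the later sum over each single count converge.
          have hpow : (2 : ℝ) ^ p * ∏ w, ((1 / 2 : ℝ) ^ letterCount y₀ w * u (letterCount y₀ w))
              = ∏ w, u (letterCount y₀ w) := by
            rw [Finset.prod_mul_distrib, Finset.prod_pow_eq_pow_sum, sum_letterCount,
              ← mul_assoc, ← mul_pow]
            norm_num
          rw [hpow]
          calc ∑ y : Fin p → S with letterCount y = letterCount y₀,
                t ^ vocabularySize y * ∏ j, empirical y (y j)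
              = (∏ w, u (letterCount y₀ w)) *
                  ∑ y : Fin p → S with letterCount y = letterCount y₀,
                    ∏ j, empirical y (y j) := by
                rw [Finset.mul_sum]
                refine Finset.sum_congr rfl fun y hy => ?_
                rw [pow_vocabularySize, (Finset.mem_filter.1 hy).2]
            _ ≤ _ := mul_le_of_le_one_right (Finset.prod_nonneg fun w _ => hu0 _)
                (sum_prod_empirical_le hp _)
        · rw [Finset.filter_false_of_mem fun y _ h => hc ⟨y, h⟩, Finset.sum_empty]
          exact mul_nonneg (by positivity)
            (Finset.prod_nonneg fun w _ => mul_nonneg (by positivity) (hu0 _))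
    _ = 2 ^ p * (∑ c ∈ Finset.range (p + 1), (1 / 2 : ℝ) ^ c * u c) ^ Fintype.card S := by
        rw [← Finset.mul_sum, ← Finset.prod_univ_sum (fun _ : S => Finset.range (p + 1))
          (fun _ c => (1 / 2 : ℝ) ^ c * u c), Finset.prod_const, Finset.card_univ]
    _ ≤ 2 ^ p * (1 + t) ^ Fintype.card S := by
        refine mul_le_mul_of_nonneg_left (pow_le_pow_left₀ (Finset.sum_nonneg fun c _ =>
          mul_nonneg (by positivity) (hu0 c)) (sum_geometric_weight_le ht p) _) (by positivity)

theorem one_add_inv_cube_pow_le_two (s : ℕ) : (1 + ((s : ℝ) ^ 3)⁻¹) ^ s ≤ 2 := by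
  rcases Nat.lt_or_ge s 2 with h | h
  -- At `s = 0` the exponent is zero, and at `s = 1` equality holds.
  · interval_cases s <;> norm_num
  · have h2 : (2 : ℝ) ≤ s := by exact_mod_cast h
    have hs : (0 : ℝ) < s := by linarith
    calc (1 + ((s : ℝ) ^ 3)⁻¹) ^ s ≤ Real.exp ((s : ℝ) ^ 3)⁻¹ ^ s := by
          gcongr
          rw [add_comm]
          exact Real.add_one_le_exp _
      _ = Real.exp ((s : ℝ) ^ 2)⁻¹ := by
          rw [← Real.exp_nat_mul]
          congr 1
          field_simp
      _ ≤ Real.exp (Real.log 2) := by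
          refine Real.exp_le_exp.2 (le_trans ?_ (le_trans (by norm_num : (1 / 4 : ℝ) ≤ 0.6931471803)
            Real.log_two_gt_d9.le))
          rw [inv_le_comm₀ (by positivity) (by norm_num)]
          nlinarith
      _ = 2 := Real.exp_log two_pos

/-- The probability of a word under a code which describes its set of letters, its letter counts,
and then the word itself by the memoryless code for these counts. -/
noncomputable def codeWeight (y : Fin p → S) : ℝ :=
  (4 ^ p)⁻¹ * ((((Fintype.card S : ℝ) ^ 3)⁻¹) ^ vocabularySize y * ∏ j, empirical y (y j))

theorem codeWeight_pos [Nonempty S] (y : Fin p → S) : 0 < codeWeight y := by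
  have hs : 0 < Fintype.card S := Fintype.card_pos
  have := Finset.prod_pos fun j (_ : j ∈ Finset.univ) => empirical_apply_pos y j
  unfold codeWeight
  positivity

/-- The total before normalisation is at most `2 ^ p * 2`, and `2 ≤ 2 ^ p` because `p` is nonzero.
-/
theorem sum_codeWeight_le_one (hp : p ≠ 0) : ∑ y : Fin p → S, codeWeight y ≤ 1 := by
  simp only [codeWeight]
  rw [← Finset.mul_sum]
  have h1 := sum_pow_vocabularySize_mul_prod_empirical_le (S := S) hp
    (t := ((Fintype.card S : ℝ) ^ 3)⁻¹) (by positivity)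
  have h2 := one_add_inv_cube_pow_le_two (Fintype.card S)
  have h3 : (2 : ℝ) ≤ 2 ^ p := by
    simpa using pow_le_pow_right₀ (one_le_two : (1 : ℝ) ≤ 2) (Nat.one_le_iff_ne_zero.2 hp)
  rw [inv_mul_le_iff₀ (by positivity), mul_one]
  calc _ ≤ _ := h1
    _ ≤ (2 : ℝ) ^ p * 2 ^ p := by
        gcongr
        exact h2.trans h3
    _ = 4 ^ p := by rw [← mul_pow]; norm_num

/-- Each letter `w` is counted `p * empirical y w` times when positions are grouped by letter. -/
theorem sum_log_empirical (y : Fin p → S) :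
    ∑ j, Real.log (empirical y (y j)) = -(p * ∑ w, Real.negMulLog (empirical y w)) := by
  rw [← Finset.sum_fiberwise (s := Finset.univ) (g := y), Finset.mul_sum, ← Finset.sum_neg_distrib]
  refine Finset.sum_congr rfl fun w _ => ?_
  have h : ∀ j ∈ Finset.univ.filter (fun j => y j = w),
      Real.log (empirical y (y j)) = Real.log (empirical y w) := fun j hj => by
    rw [(Finset.mem_filter.1 hj).2]
  rw [Finset.sum_congr rfl h, Finset.sum_const, nsmul_eq_mul, Real.negMulLog]
  rcases Nat.eq_zero_or_pos p with rfl | hp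
  · simp
  · have : (p : ℝ) ≠ 0 := by positivity
    rw [show ((Finset.univ.filter fun j => y j = w).card : ℝ) = p * empirical y w by
      rw [empirical, letterCount]; field_simp]
    ring

theorem neg_log_codeWeight [Nonempty S] (y : Fin p → S) :
    -Real.log (codeWeight y) = p * ∑ w, Real.negMulLog (empirical y w)
      + 3 * Real.log (Fintype.card S) * vocabularySize y + p * Real.log 4 := by
  have hs : (Fintype.card S : ℝ) ≠ 0 := by exact_mod_cast Fintype.card_ne_zero
  have hpos := Finset.prod_pos fun j (_ : j ∈ Finset.univ) => empirical_apply_pos y j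
  rw [codeWeight, Real.log_mul (by positivity) (by positivity),
    Real.log_mul (by positivity) hpos.ne', Real.log_prod fun j _ => (empirical_apply_pos y j).ne',
    sum_log_empirical, Real.log_pow, Real.log_inv, Real.log_inv, Real.log_pow, Real.log_pow]
  push_cast
  ring

end Code

/-! ### Expected code length: conditional Jensen and the vocabulary bound -/

section Expectation

variable {Ω S : Type*} {m : MeasurableSpace Ω} [mΩ : MeasurableSpace Ω] {μ : Measure Ω}
  [IsProbabilityMeasure μ]

theorem integrable_comp_of_mem_Icc {φ : ℝ → ℝ} (hφ : Continuous φ) {f : Ω → ℝ}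
    (hf : AEStronglyMeasurable f μ) (h01 : ∀ᵐ ω ∂μ, f ω ∈ Set.Icc (0 : ℝ) 1) :
    Integrable (fun ω => φ (f ω)) μ := by
  obtain ⟨C, hC⟩ := isCompact_Icc.exists_bound_of_continuousOn (s := Set.Icc (0 : ℝ) 1)
    hφ.continuousOn
  exact Integrable.of_bound (hφ.comp_aestronglyMeasurable hf) C
    (h01.mono fun ω h => hC _ h)

theorem condProb_mem_Icc (hm : m ≤ mΩ) {s : Set Ω} (hs : MeasurableSet s) :
    ∀ᵐ ω ∂μ, (μ⟦s | m⟧) ω ∈ Set.Icc (0 : ℝ) 1 := by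
  have hint : Integrable (s.indicator fun _ : Ω => (1 : ℝ)) μ :=
    (integrable_const 1).indicator hs
  have h0 : 0 ≤ᵐ[μ] μ⟦s | m⟧ :=
    condExp_nonneg (.of_forall fun ω => Set.indicator_nonneg (fun _ _ => zero_le_one) ω)
  have h1 : μ⟦s | m⟧ ≤ᵐ[μ] μ[fun _ : Ω => (1 : ℝ) | m] :=
    condExp_mono hint (integrable_const 1)
      (.of_forall fun ω => Set.indicator_le_self' (fun _ _ => zero_le_one) ω)
  rw [condExp_const hm] at h1
  filter_upwards [h0, h1] with ω h0 h1 using ⟨h0, h1⟩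

theorem aestronglyMeasurable_condExp {Ω : Type*} {m mΩ : MeasurableSpace Ω} {μ : Measure Ω}
    (hm : m ≤ mΩ) (f : Ω → ℝ) : AEStronglyMeasurable (μ[f | m]) μ :=
  (stronglyMeasurable_condExp.mono hm).aestronglyMeasurable

theorem sum_condProb_eq_one [Fintype S] [MeasurableSpace S] [MeasurableSingletonClass S]
    (hm : m ≤ mΩ) {Z : Ω → S} (hZ : Measurable Z) :
    ∀ᵐ ω ∂μ, ∑ w, (μ⟦Z ⁻¹' {w} | m⟧) ω = 1 := by
  have h := condExp_finsetSum (μ := μ) (s := Finset.univ)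
    (f := fun w => (Z ⁻¹' {w}).indicator fun _ : Ω => (1 : ℝ))
    (fun w _ => (integrable_const 1).indicator (hZ (measurableSet_singleton w))) m
  have hsum : ∑ w, (Z ⁻¹' {w}).indicator (fun _ : Ω => (1 : ℝ)) = fun _ => 1 := by
    classical
    ext ω
    simp [Finset.sum_apply, Set.indicator_apply]
  rw [hsum, condExp_const hm] at h
  filter_upwards [h] with ω h
  simpa [Finset.sum_apply] using h.symm

/-- A linear bound for the truncation of the self-information, by Markov's inequality. -/
theorem min_mul_one_le {p h x : ℝ} (hp : 1 ≤ p) (hh : 0 < h) (hx0 : 0 ≤ x) (hx1 : x ≤ 1) :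
    min (p * x) 1 ≤ p * (min (Real.exp (h - Real.log p)) 1 * x
      + (1 - min (Real.exp (h - Real.log p)) 1) * (Real.negMulLog x / h)) := by
  set s := min (Real.exp (h - Real.log p)) 1 with hs
  have hp0 : 0 < p := by linarith
  have hs1 : s ≤ 1 := min_le_right _ _
  have hs0 : 0 < s := lt_min (Real.exp_pos _) one_pos
  have hneg := Real.negMulLog_nonneg hx0 hx1
  rcases hx0.eq_or_lt with rfl | hx
  · simp
  -- If the self-information is at most `h`, then `exp h * x ≥ 1` and the first summand alone
  -- suffices. Otherwise `x` is below `negMulLog x / h`, hence below the convex combination.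
  rcases le_or_gt (-Real.log x) h with hle | hgt
  · have h1 : min (p * x) 1 ≤ p * (s * x) := by
      rw [hs, min_mul_of_nonneg _ _ hx0, one_mul, mul_min_of_nonneg _ _ hp0.le, min_comm]
      refine min_le_min_right _ ?_
      rw [Real.exp_sub, Real.exp_log hp0]
      have : x⁻¹ ≤ Real.exp h := by
        rw [← Real.exp_log (inv_pos.2 hx), Real.log_inv]
        exact Real.exp_le_exp.2 hle
      have h2 : 1 ≤ Real.exp h * x := by
        rwa [inv_le_iff_one_le_mul₀ hx] at this
      calc (1 : ℝ) ≤ Real.exp h * x := h2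
        _ = p * (Real.exp h / p * x) := by field_simp
    have : 0 ≤ (1 - s) * (Real.negMulLog x / h) :=
      mul_nonneg (by linarith) (div_nonneg hneg hh.le)
    nlinarith
  · have h1 : x ≤ Real.negMulLog x / h := by
      rw [le_div_iff₀ hh, Real.negMulLog]
      nlinarith
    refine (min_le_left _ _).trans (mul_le_mul_of_nonneg_left ?_ hp0.le)
    nlinarith

/-- The expected size of the vocabulary is bounded in terms of the conditional entropy `h`. -/
theorem sum_integral_min_le [Fintype S] {r : S → Ω → ℝ}
    (hrm : ∀ w, AEStronglyMeasurable (r w) μ)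
    (hr01 : ∀ w, ∀ᵐ ω ∂μ, r w ω ∈ Set.Icc (0 : ℝ) 1) (hr1 : ∀ᵐ ω ∂μ, ∑ w, r w ω = 1)
    {p t : ℝ} (hp : 1 ≤ p) (ht : 1 ≤ t) {h : ℝ}
    (hh : h = ∑ w, ∫ ω, Real.negMulLog (r w ω) ∂μ) :
    ∑ w, ∫ ω, min (p * r w ω) 1 ∂μ
      ≤ p * (1 / t + (1 - 1 / t) * min (Real.exp (t * h - Real.log p)) 1) := by
  have hp0 : 0 < p := by linarith
  have ht0 : 0 < t := by linarith
  have hint : ∀ {φ : ℝ → ℝ}, Continuous φ → ∀ w, Integrable (fun ω => φ (r w ω)) μ :=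
    fun hφ w => integrable_comp_of_mem_Icc hφ (hrm w) (hr01 w)
  have hmin : Continuous fun x : ℝ => min (p * x) 1 := by fun_prop
  have hmass : ∑ w, ∫ ω, r w ω ∂μ = 1 := by
    have hid : ∀ w, Integrable (r w) μ := hint continuous_id
    rw [← integral_finsetSum _ fun w _ => hid w, integral_congr_ae hr1]
    simp
  have hnn : ∀ w, 0 ≤ᵐ[μ] fun ω => Real.negMulLog (r w ω) := fun w =>
    (hr01 w).mono fun ω h => Real.negMulLog_nonneg h.1 h.2
  have hh0 : 0 ≤ h := hh ▸ Finset.sum_nonneg fun w _ => integral_nonneg_of_ae (hnn w)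
  have ht1 : 1 / t ≤ 1 := (div_le_one ht0).2 ht
  -- For `h = 0` the threshold `t * h` cannot be divided by. Then each `r w` is almost surely 0 or
  -- 1, so the left side is at most the total mass 1, while the truncated exponential equals `1 /
  -- p`.
  rcases hh0.eq_or_lt with h0 | hpos
  · have hzero : ∀ w, ∀ᵐ ω ∂μ, Real.negMulLog (r w ω) = 0 := by
      intro w
      refine (integral_eq_zero_iff_of_nonneg_ae (hnn w) (hint Real.continuous_negMulLog w)).1 ?_
      exact (Finset.sum_eq_zero_iff_of_nonneg fun w _ => integral_nonneg_of_ae (hnn w)).1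
        (hh.symm.trans h0.symm) w (Finset.mem_univ w)
    have hle : ∀ w, ∫ ω, min (p * r w ω) 1 ∂μ ≤ ∫ ω, r w ω ∂μ := by
      intro w
      refine integral_mono_ae (hint hmin w) (hint continuous_id w) ?_
      filter_upwards [hzero w, hr01 w] with ω h1 h2
      rcases h2.1.eq_or_lt with h3 | h3
      · simp [← h3]
      · have h4 : Real.log (r w ω) = 0 := by
          rcases mul_eq_zero.1 h1 with h5 | h5
          · linarith
          · exact h5
        have h5 : r w ω = 1 := Real.eq_one_of_pos_of_log_eq_zero h3 h4
        simp [h5]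
    have hexp : min (Real.exp (t * h - Real.log p)) 1 = 1 / p := by
      rw [← h0, mul_zero, zero_sub, Real.exp_neg, Real.exp_log hp0, one_div]
      exact min_eq_left (inv_le_one_of_one_le₀ hp)
    have h1p : 1 / p ≤ 1 := (div_le_one hp0).2 hp
    have h1t : 0 ≤ 1 / t := by positivity
    calc ∑ w, ∫ ω, min (p * r w ω) 1 ∂μ ≤ 1 :=
          (Finset.sum_le_sum fun w _ => hle w).trans hmass.le
      _ = p * (1 / p) := by field_simp
      _ ≤ _ := by
          rw [hexp]
          refine mul_le_mul_of_nonneg_left ?_ hp0.le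
          nlinarith
  · set s := min (Real.exp (t * h - Real.log p)) 1
    have hle : ∀ w, ∫ ω, min (p * r w ω) 1 ∂μ ≤ p * (s * ∫ ω, r w ω ∂μ
        + (1 - s) * ((∫ ω, Real.negMulLog (r w ω) ∂μ) / (t * h))) := by
      intro w
      have i1 : Integrable (fun ω => s * r w ω) μ := (hint continuous_id w).const_mul s
      have i2 : Integrable (fun ω => (1 - s) * (Real.negMulLog (r w ω) / (t * h))) μ :=
        ((hint Real.continuous_negMulLog w).div_const _).const_mul _
      rw [← integral_const_mul, ← integral_div, ← integral_const_mul, ← integral_add i1 i2,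
        ← integral_const_mul]
      refine integral_mono_ae (hint hmin w) ((i1.add i2).const_mul p) ?_
      filter_upwards [hr01 w] with ω h1
      exact min_mul_one_le hp (by positivity) h1.1 h1.2
    -- The masses sum to 1 and the entropies to `h`, leaving `s + (1 - s) / t`, which rearranges to
    -- the claim.
    refine (Finset.sum_le_sum fun w _ => hle w).trans_eq ?_
    rw [← Finset.mul_sum, Finset.sum_add_distrib, ← Finset.mul_sum, ← Finset.mul_sum,
      ← Finset.sum_div, ← hh, hmass]
    field_simp
    ring

variable [DecidableEq S] {p : ℕ}

theorem empirical_mem_Icc (y : Fin p → S) (w : S) : empirical y w ∈ Set.Icc (0 : ℝ) 1 := by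
  refine ⟨by unfold empirical; positivity, ?_⟩
  exact div_le_one_of_le₀ (by exact_mod_cast letterCount_le y w) (by positivity)

theorem empirical_eq_sum_indicator {Ω : Type*} (Y : Ω → Fin p → S) (w : S) :
    (fun ω => empirical (Y ω) w)
      = (p : ℝ)⁻¹ • ∑ j, ((fun ω => Y ω j) ⁻¹' {w}).indicator fun _ : Ω => (1 : ℝ) := by
  ext ω
  have h : ∀ j, ((fun ω => Y ω j) ⁻¹' {w}).indicator (fun _ : Ω => (1 : ℝ)) ω
      = if Y ω j = w then 1 else 0 := fun j => by
    by_cases hj : Y ω j = w <;> simp [hj]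
  simp only [empirical, letterCount, Pi.smul_apply, Finset.sum_apply, div_eq_inv_mul, h,
    Finset.sum_boole, smul_eq_mul]

/-- An integer count truncated at 1 indicates occurrence. This form is concave in the frequencies,
as Jensen requires. -/
theorem vocabularySize_eq_sum [Fintype S] (hp : p ≠ 0) (y : Fin p → S) :
    (vocabularySize y : ℝ) = ∑ w, min (p * empirical y w) 1 := by
  have hp' : (p : ℝ) ≠ 0 := by exact_mod_cast hp
  have h : ∀ w, min (p * empirical y w) 1 = if w ∈ Finset.univ.image y then (1 : ℝ) else 0 := by
    intro w
    rw [empirical, mul_div_cancel₀ _ hp']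
    have hw := letterCount_eq_zero_iff y w
    split_ifs with h
    · have : 1 ≤ letterCount y w := Nat.one_le_iff_ne_zero.2 fun h0 => hw.1 h0 h
      exact min_eq_right (by exact_mod_cast this)
    · rw [hw.2 h]
      simp
  simp only [h, Finset.sum_boole, vocabularySize, Finset.filter_mem_eq_inter, Finset.univ_inter]

variable [MeasurableSpace S] [MeasurableSingletonClass S]

theorem condExp_empirical (hp : p ≠ 0) {Y : Ω → Fin p → S}
    (hY : ∀ j, Measurable fun ω => Y ω j) {w : S} {r : Ω → ℝ}
    (hr : ∀ j, μ⟦(fun ω => Y ω j) ⁻¹' {w} | m⟧ =ᵐ[μ] r) :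
    μ[fun ω => empirical (Y ω) w | m] =ᵐ[μ] r := by
  rw [empirical_eq_sum_indicator]
  have h := condExp_finsetSum (μ := μ) (s := Finset.univ)
    (f := fun j => ((fun ω => Y ω j) ⁻¹' {w}).indicator fun _ : Ω => (1 : ℝ))
    (fun j _ => (integrable_const 1).indicator (hY j (measurableSet_singleton w))) m
  filter_upwards [condExp_smul (μ := μ) (p : ℝ)⁻¹
    (∑ j, ((fun ω => Y ω j) ⁻¹' {w}).indicator fun _ : Ω => (1 : ℝ)) m, h,
    ae_all_iff.2 hr] with ω h1 h2 h3
  have hp' : (p : ℝ) ≠ 0 := by exact_mod_cast hp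
  rw [h1, Pi.smul_apply, h2, Finset.sum_apply, Finset.sum_congr rfl fun j _ => h3 j]
  simp [hp']

theorem measurable_empirical {Y : Ω → Fin p → S} (hY : ∀ j, Measurable fun ω => Y ω j) (w : S) :
    Measurable fun ω => empirical (Y ω) w := by
  rw [empirical_eq_sum_indicator]
  have h : Measurable (∑ j, ((fun ω => Y ω j) ⁻¹' {w}).indicator fun _ : Ω => (1 : ℝ)) := by
    refine Finset.sum_induction _ Measurable (fun _ _ => Measurable.add) measurable_zero
      fun j _ => ?_
    exact measurable_const.indicator (hY j (measurableSet_singleton w))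
  exact h.const_smul _

/-- Jensen's inequality for the empirical distribution of letters with a common conditional
distribution. -/
theorem integral_concave_empirical_le (hm : m ≤ mΩ) (hp : p ≠ 0) {φ : ℝ → ℝ} (hφ : Continuous φ)
    (hφc : ConcaveOn ℝ (Set.Ici 0) φ) {Y : Ω → Fin p → S}
    (hY : ∀ j, Measurable fun ω => Y ω j) {w : S} {r : Ω → ℝ}
    (hr : ∀ j, μ⟦(fun ω => Y ω j) ⁻¹' {w} | m⟧ =ᵐ[μ] r) :
    ∫ ω, φ (empirical (Y ω) w) ∂μ ≤ ∫ ω, φ (r ω) ∂μ := by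
  have hemp := (measurable_empirical hY w).aestronglyMeasurable (μ := μ)
  have h01 : ∀ᵐ ω ∂μ, empirical (Y ω) w ∈ Set.Icc (0 : ℝ) 1 :=
    .of_forall fun ω => empirical_mem_Icc _ _
  have hint := integrable_comp_of_mem_Icc hφ hemp h01
  have hJ := hφc.condExp_map_le hm (hφ.upperSemicontinuous.upperSemicontinuousOn _)
    (h01.mono fun ω h => h.1) isClosed_Ici
    (integrable_comp_of_mem_Icc continuous_id hemp h01) hint
  have hr' := condExp_empirical hp hY hr
  have j₀ : Fin p := ⟨0, Nat.pos_of_ne_zero hp⟩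
  have hr01 : ∀ᵐ ω ∂μ, r ω ∈ Set.Icc (0 : ℝ) 1 := by
    filter_upwards [hr j₀, condProb_mem_Icc hm (hY j₀ (measurableSet_singleton w))] with ω h1 h2
    rwa [← h1]
  have hrm : AEStronglyMeasurable r μ := (aestronglyMeasurable_condExp hm _).congr (hr j₀)
  calc ∫ ω, φ (empirical (Y ω) w) ∂μ
      = ∫ ω, (μ[fun ω => φ (empirical (Y ω) w) | m]) ω ∂μ := (integral_condExp hm).symm
    _ ≤ ∫ ω, φ (r ω) ∂μ := by
        refine integral_mono_ae integrable_condExp (integrable_comp_of_mem_Icc hφ hrm hr01) ?_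
        filter_upwards [hJ, hr'] with ω h1 h2
        rw [← h2]
        exact h1

theorem concaveOn_min_mul_one (c : ℝ) : ConcaveOn ℝ (Set.Ici 0) fun x : ℝ => min (c * x) 1 := by
  have h : ConcaveOn ℝ (Set.Ici (0 : ℝ)) fun x : ℝ => c * x :=
    (LinearMap.mul ℝ ℝ c).concaveOn (convex_Ici 0)
  exact h.inf (concaveOn_const 1 (convex_Ici 0))

/-- The entropy of a random variable is at most its expected code length. -/
theorem sum_negMulLog_le_integral_neg_log {T : Type*} [Fintype T] [MeasurableSpace T]
    [MeasurableSingletonClass T] {U : Ω → T} (hU : Measurable U) {Q : T → ℝ}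
    (hQ : ∀ x, 0 < Q x) (hQ1 : ∑ x, Q x ≤ 1) :
    ∑ x, Real.negMulLog (μ.real (U ⁻¹' {x})) ≤ ∫ ω, -Real.log (Q (U ω)) ∂μ := by
  have hmap : ∀ x, (μ.map U).real {x} = μ.real (U ⁻¹' {x}) := fun x =>
    map_measureReal_apply hU (measurableSet_singleton x)
  have : IsProbabilityMeasure (μ.map U) := Measure.isProbabilityMeasure_map hU.aemeasurable
  have hg : Measurable fun x => -Real.log (Q x) := measurable_of_finite _
  rw [← integral_map hU.aemeasurable hg.aestronglyMeasurable, integral_fintype .of_finite]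
  simp only [← hmap, smul_eq_mul]
  refine sum_negMulLog_le_sum_mul_neg_log (fun _ => measureReal_nonneg) ?_ hQ hQ1
  rw [sum_measureReal_singleton]
  simp

/-- Entropy bound for a word whose letters have the common conditional distribution `r`. -/
theorem sum_negMulLog_le_condEntropy_add [Fintype S] (hm : m ≤ mΩ) (hp : p ≠ 0)
    {Y : Ω → Fin p → S} (hY : ∀ j, Measurable fun ω => Y ω j) {r : S → Ω → ℝ}
    (hr : ∀ j w, μ⟦(fun ω => Y ω j) ⁻¹' {w} | m⟧ =ᵐ[μ] r w) :
    ∑ y, Real.negMulLog (μ.real (Y ⁻¹' {y}))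
      ≤ p * (∑ w, ∫ ω, Real.negMulLog (r w ω) ∂μ)
        + 3 * Real.log (Fintype.card S) * (∑ w, ∫ ω, min (p * r w ω) 1 ∂μ)
        + p * Real.log 4 := by
  have hΩ : Nonempty Ω := nonempty_of_isProbabilityMeasure μ
  have hS : Nonempty S := hΩ.map fun ω => Y ω ⟨0, Nat.pos_of_ne_zero hp⟩
  have hint : ∀ {φ : ℝ → ℝ}, Continuous φ → ∀ w, Integrable (fun ω => φ (empirical (Y ω) w)) μ :=
    fun hφ w => integrable_comp_of_mem_Icc hφ (measurable_empirical hY w).aestronglyMeasurable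
      (.of_forall fun ω => empirical_mem_Icc _ _)
  have hmin : Continuous fun x : ℝ => min ((p : ℝ) * x) 1 := by fun_prop
  have h1 := integrable_finsetSum Finset.univ fun w _ => hint Real.continuous_negMulLog w
  have h2 := integrable_finsetSum Finset.univ fun w _ => hint hmin w
  have hcard : 0 ≤ Real.log (Fintype.card S) := Real.log_natCast_nonneg _
  calc ∑ y, Real.negMulLog (μ.real (Y ⁻¹' {y}))
      ≤ ∫ ω, -Real.log (codeWeight (Y ω)) ∂μ :=
        sum_negMulLog_le_integral_neg_log (measurable_pi_iff.2 hY) codeWeight_pos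
          (sum_codeWeight_le_one hp)
    _ = p * (∑ w, ∫ ω, Real.negMulLog (empirical (Y ω) w) ∂μ)
        + 3 * Real.log (Fintype.card S) * (∑ w, ∫ ω, min (p * empirical (Y ω) w) 1 ∂μ)
        + p * Real.log 4 := by
        simp only [neg_log_codeWeight, vocabularySize_eq_sum hp]
        have h3 := (h1.const_mul (p : ℝ)).add (h2.const_mul (3 * Real.log (Fintype.card S)))
        refine (integral_add h3 (integrable_const _)).trans ?_
        refine (congrArg (· + _) (integral_add (h1.const_mul _) (h2.const_mul _))).trans ?_
        rw [integral_const_mul, integral_const_mul,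
          integral_finsetSum _ fun w _ => hint Real.continuous_negMulLog w,
          integral_finsetSum _ fun w _ => hint hmin w]
        simp
    _ ≤ _ := by
        have h4 := fun w => integral_concave_empirical_le hm hp Real.continuous_negMulLog
          Real.concaveOn_negMulLog hY fun j => hr j w
        have h5 := fun w => integral_concave_empirical_le hm hp hmin (concaveOn_min_mul_one _) hY
          fun j => hr j w
        exact add_le_add_left (add_le_add
          (mul_le_mul_of_nonneg_left (Finset.sum_le_sum fun w _ => h4 w) (Nat.cast_nonneg p))
          (mul_le_mul_of_nonneg_left (Finset.sum_le_sum fun w _ => h5 w) (by positivity))) _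

end Expectation

/-! ### Blocks of a stationary process and the invariant σ-algebra -/

section Stationary

variable {Ω A : Type*}

theorem shift_iterate (i : ℕ) (x : ℤ → A) (l : ℤ) : shift^[i] x l = x (l + i) := by
  induction i generalizing x with
  | zero => simp
  | succ i ih =>
    rw [Function.iterate_succ_apply, ih, shift]
    congr 1
    push_cast
    ring

/-- The `j`-th of the consecutive blocks of length `k`. -/
def nthBlock (X : ℤ → Ω → A) (k j : ℕ) (ω : Ω) : Fin k → A :=
  fun i => X ((i : ℤ) + 1 + ((k * j : ℕ) : ℤ)) ω

theorem nthBlock_zero (X : ℤ → Ω → A) (k : ℕ) : nthBlock X k 0 = block X k := by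
  ext ω i
  simp [nthBlock, block]

/-- A word of length `p * k` consists of `p` words of length `k`. -/
def blockEquiv (A : Type*) (p k : ℕ) : (Fin (p * k) → A) ≃ (Fin p → Fin k → A) :=
  (Equiv.arrowCongr finProdFinEquiv.symm (Equiv.refl A)).trans (Equiv.curry _ _ _)

theorem blockEquiv_block (X : ℤ → Ω → A) (p k : ℕ) (ω : Ω) :
    blockEquiv A p k (block X (p * k) ω) = fun j : Fin p => nthBlock X k j ω := by
  ext j i
  simp only [blockEquiv, Equiv.trans_apply, Equiv.curry_apply, Function.curry,
    Equiv.arrowCongr_apply, Function.comp_apply, Equiv.symm_symm, Equiv.refl_apply, block,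
    nthBlock, finProdFinEquiv_apply_val]
  congr 1
  push_cast
  ring

variable {m : MeasurableSpace Ω} [mΩ : MeasurableSpace Ω] [MeasurableSpace A]

theorem measurable_nthBlock {X : ℤ → Ω → A} (hX : ∀ i, Measurable (X i)) (k j : ℕ) :
    Measurable (nthBlock X k j) :=
  measurable_pi_iff.2 fun _ => hX _

variable {μ : Measure Ω} {X : ℤ → Ω → A}

theorem entropy_eq_div {S : Type*} [Fintype S] (b : ℝ) (Y : Ω → S) :
    entropy b μ Y = (∑ w, Real.negMulLog (μ.real (Y ⁻¹' {w}))) / Real.log b := by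
  rw [entropy, Finset.sum_div, ← Finset.sum_neg_distrib]
  refine Finset.sum_congr rfl fun w _ => ?_
  rw [Real.negMulLog, Real.logb]
  ring

theorem sum_negMulLog_block {A : Type*} [Fintype A] (X : ℤ → Ω → A) (p k : ℕ) :
    ∑ x, Real.negMulLog (μ.real (block X (p * k) ⁻¹' {x}))
      = ∑ y, Real.negMulLog (μ.real ((fun ω (j : Fin p) => nthBlock X k j ω) ⁻¹' {y})) := by
  refine Fintype.sum_equiv (blockEquiv A p k) _ _ fun x => ?_
  congr 2
  ext ω
  simp only [Set.mem_preimage, Set.mem_singleton_iff, ← blockEquiv_block,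
    (blockEquiv A p k).injective.eq_iff]

variable [IsProbabilityMeasure μ]

/-- An invariant `B` is its own preimage under the iterated shift, so intersecting it with the
preimage of `E` gives the preimage of `B ∩ E`, of equal measure. The two conditional probabilities
thus have the same integrals over all invariant events. -/
theorem IsStationary.condProb_shift (hstat : IsStationary X μ) (hX : ∀ i, Measurable (X i))
    (i : ℕ) {E : Set (ℤ → A)} (hE : MeasurableSet E) :
    μ⟦path X ⁻¹' (shift^[i] ⁻¹' E) | invariantAlgebra X⟧
      =ᵐ[μ] μ⟦path X ⁻¹' E | invariantAlgebra X⟧ := by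
  have hI := invariantAlgebra_le X hX
  have hpath : Measurable (path X) := measurable_pi_iff.2 hX
  have hiter := hstat.iterate i
  have hint : ∀ {F : Set (ℤ → A)}, MeasurableSet F →
      Integrable ((path X ⁻¹' F).indicator fun _ : Ω => (1 : ℝ)) μ := fun hF =>
    (integrable_const 1).indicator (hpath hF)
  have hE' := hiter.measurable hE
  symm
  refine ae_eq_condExp_of_forall_setIntegral_eq hI (hint hE')
    (fun s _ _ => integrable_condExp.integrableOn) ?_
    stronglyMeasurable_condExp.aestronglyMeasurable
  intro s hs _
  rw [setIntegral_condExp hI (hint hE) hs]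
  obtain ⟨B, ⟨hB, hBinv⟩, rfl⟩ := hs
  have hBi : shift^[i] ⁻¹' B = B := by
    rw [Set.preimage_iterate_eq]
    exact Function.iterate_fixed hBinv i
  rw [setIntegral_indicator (hpath hE), setIntegral_indicator (hpath hE'), setIntegral_const,
    setIntegral_const]
  congr 1
  rw [← Set.preimage_inter, ← Set.preimage_inter, ← map_measureReal_apply hpath (hB.inter hE),
    ← map_measureReal_apply hpath (hB.inter hE')]
  nth_rewrite 2 [← hBi]
  rw [← Set.preimage_inter]
  exact (hiter.measureReal_preimage (hB.inter hE).nullMeasurableSet).symm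

theorem IsStationary.condProb_nthBlock [MeasurableSingletonClass A]
    (hstat : IsStationary X μ) (hX : ∀ i, Measurable (X i)) (k j : ℕ) (w : Fin k → A) :
    μ⟦nthBlock X k j ⁻¹' {w} | invariantAlgebra X⟧
      =ᵐ[μ] μ⟦block X k ⁻¹' {w} | invariantAlgebra X⟧ := by
  have hmeas : Measurable fun (x : ℤ → A) (i : Fin k) => x ((i : ℤ) + 1) :=
    measurable_pi_iff.2 fun i => measurable_pi_apply _
  have h := hstat.condProb_shift hX (k * j) (hmeas (measurableSet_singleton w))
  have h1 : path X ⁻¹' (shift^[k * j] ⁻¹'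
      ((fun (x : ℤ → A) (i : Fin k) => x ((i : ℤ) + 1)) ⁻¹' {w}))
      = nthBlock X k j ⁻¹' {w} := by
    ext ω
    simp only [Set.mem_preimage, shift_iterate, path]
    rfl
  rwa [h1] at h

theorem condEntropy_eq_div {S : Type*} [Fintype S] [MeasurableSpace S] [MeasurableSingletonClass S]
    (b : ℝ) {Y : Ω → S} (hY : Measurable Y) (hm : m ≤ mΩ) :
    condEntropy b μ Y m
      = (∑ w, ∫ ω, Real.negMulLog ((μ⟦Y ⁻¹' {w} | m⟧) ω) ∂μ) / Real.log b := by
  have hint : ∀ w, Integrable (fun ω => Real.negMulLog ((μ⟦Y ⁻¹' {w} | m⟧) ω)) μ := fun w =>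
    integrable_comp_of_mem_Icc Real.continuous_negMulLog (aestronglyMeasurable_condExp hm _)
      (condProb_mem_Icc hm (hY (measurableSet_singleton w)))
  rw [condEntropy, ← integral_finsetSum _ fun w _ => hint w, ← integral_div]
  refine integral_congr_ae (.of_forall fun ω => ?_)
  simp only
  rw [Finset.sum_div, ← Finset.sum_neg_distrib]
  refine Finset.sum_congr rfl fun w _ => ?_
  rw [Real.negMulLog, Real.logb]
  ring

/-- The entropy bound for consecutive blocks, in natural units. -/
theorem IsStationary.sum_negMulLog_block_le [Fintype A] [MeasurableSingletonClass A]
    (hstat : IsStationary X μ) (hX : ∀ i, Measurable (X i)) {p k : ℕ} (hp : 1 ≤ p)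
    {t h : ℝ} (ht : 1 ≤ t)
    (hh : h = ∑ w, ∫ ω, Real.negMulLog ((μ⟦block X k ⁻¹' {w} | invariantAlgebra X⟧) ω) ∂μ) :
    ∑ x, Real.negMulLog (μ.real (block X (p * k) ⁻¹' {x}))
      ≤ p * h + 3 * (k * Real.log (Fintype.card A))
          * (p * (1 / t + (1 - 1 / t) * min (Real.exp (t * h - Real.log p)) 1))
        + p * Real.log 4 := by
  classical
  have hI := invariantAlgebra_le X hX
  have hb : Measurable (block X k) := nthBlock_zero X k ▸ measurable_nthBlock hX k 0
  have hV := sum_integral_min_le (μ := μ)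
    (r := fun w => μ⟦block X k ⁻¹' {w} | invariantAlgebra X⟧)
    (fun w => aestronglyMeasurable_condExp hI _)
    (fun w => condProb_mem_Icc hI (hb (measurableSet_singleton w)))
    (sum_condProb_eq_one hI hb) (p := p) (by exact_mod_cast hp) ht hh
  have hH := sum_negMulLog_le_condEntropy_add hI (Nat.one_le_iff_ne_zero.1 hp)
    (Y := fun ω (j : Fin p) => nthBlock X k j ω) (fun j => measurable_nthBlock hX k j)
    (fun j w => hstat.condProb_nthBlock hX k j w)
  rw [sum_negMulLog_block, hh]
  refine hH.trans ?_
  -- There are `|A| ^ k` possible blocks, so each distinct block costs `3 * k * log |A|`.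
  rw [← hh, Fintype.card_fun, Fintype.card_fin, Nat.cast_pow, Real.log_pow]
  have hlog : 0 ≤ Real.log (Fintype.card A) := Real.log_natCast_nonneg _
  gcongr

end Stationary

end BlockEntropy

theorem theorem2 {Ω A : Type*} [MeasurableSpace Ω] (μ : Measure Ω) [IsProbabilityMeasure μ]
    [Fintype A] [MeasurableSpace A] [MeasurableSingletonClass A]
    (X : ℤ → Ω → A) (hX : ∀ i, Measurable (X i)) (hstat : BlockEntropy.IsStationary X μ)
    (b : ℝ) (hb : 2 ≤ b)
    (p k n : ℕ) (hp : 1 ≤ p) (hk : 1 ≤ k) (hn : n = p * k) (m : ℝ) (hm : 1 ≤ m) :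
    BlockEntropy.entropy b μ (BlockEntropy.block X n) / n
        - BlockEntropy.condEntropy b μ (BlockEntropy.block X k)
            (BlockEntropy.invariantAlgebra X) / k
      ≤ 2 / k + 2 / n * Real.logb b k
        + 3 * Real.logb b (Fintype.card A)
          * (1 / m
            + (1 - 1 / m)
              * BlockEntropy.cutExp b
                  (m * BlockEntropy.condEntropy b μ (BlockEntropy.block X k)
                      (BlockEntropy.invariantAlgebra X)
                    - Real.logb b ((n : ℝ) / k))
            + (k : ℝ) / n) := by
  subst hn
  have hI := BlockEntropy.invariantAlgebra_le X hX
  have hbl : Measurable (BlockEntropy.block X k) :=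
    BlockEntropy.nthBlock_zero X k ▸ BlockEntropy.measurable_nthBlock hX k 0
  obtain ⟨h, hh⟩ : ∃ h, h = ∑ w, ∫ ω, Real.negMulLog
    ((μ⟦BlockEntropy.block X k ⁻¹' {w} | BlockEntropy.invariantAlgebra X⟧) ω) ∂μ := ⟨_, rfl⟩
  have key := hstat.sum_negMulLog_block_le hX (p := p) (k := k) hp hm hh
  have hp0 : (0 : ℝ) < p := by exact_mod_cast hp
  have hk0 : (0 : ℝ) < k := by exact_mod_cast hk
  have hb0 : 0 < b := by linarith
  have hlb : 0 < Real.log b := Real.log_pos (by linarith)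
  have h4 : Real.log 4 ≤ 2 * Real.log b := by
    rw [show (4 : ℝ) = 2 ^ 2 by norm_num, Real.log_pow]
    have := Real.log_le_log two_pos hb
    push_cast
    linarith
  -- The truncated exponential does not depend on the base once entropies are rescaled by `log b`.
  have hcut : BlockEntropy.cutExp b (m * (h / Real.log b) - Real.logb b p)
      = min (Real.exp (m * h - Real.log p)) 1 := by
    rw [BlockEntropy.cutExp, Real.rpow_def_of_pos hb0, Real.logb]
    congr 2
    field_simp
  rw [BlockEntropy.entropy_eq_div, BlockEntropy.condEntropy_eq_div b hbl hI, ← hh,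
    show ((p * k : ℕ) : ℝ) / k = p by push_cast; field_simp, hcut, Real.logb, Real.logb]
  set s := min (Real.exp (m * h - Real.log p)) 1
  set V := 1 / m + (1 - 1 / m) * s
  set L := Real.log (Fintype.card A)
  have hL : 0 ≤ L := Real.log_natCast_nonneg _
  have hlk : 0 ≤ Real.log k := Real.log_natCast_nonneg _
  calc _ ≤ (p * h + 3 * (k * L) * (p * V) + p * (2 * Real.log b)) / Real.log b / (p * k : ℕ)
        - h / Real.log b / k := by
        gcongr
        exact key.trans (by gcongr)
    _ = 2 / k + 3 * (L / Real.log b) * V := by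
        push_cast
        field_simp
        ring
    -- The terms with `log k` and `k / n` are nonnegative slack.
    _ ≤ 2 / k + 2 / (p * k : ℕ) * (Real.log k / Real.log b)
        + 3 * (L / Real.log b) * (V + k / (p * k : ℕ)) := by
        have h1 : 0 ≤ 2 / ((p * k : ℕ) : ℝ) * (Real.log k / Real.log b) := by positivity
        have h2 : 0 ≤ (k : ℝ) / (p * k : ℕ) := by positivity
        have h3 : 3 * (L / Real.log b) * V ≤ 3 * (L / Real.log b) * (V + k / (p * k : ℕ)) := by
          gcongr
          linarith
        linarith
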